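/- **Fundamental intervals.** Put $I_0:=[0,1)$, and give this interval the label $0$. All intervals below are closed on the left and open on the right. A finite word $k_1\cdots k_n$ of non-negative integers is *admissible* if $k_1\neq0$ and $k_i=0$ implies $k_{i+1}\ne 0$; an infinite sequence is admissible if all its initial words are. For the empty word ($n=0$) read $I_{k_1\cdots k_n}$ as $I_0$ and $k_n$ as $0$. Given $I=I_{k_1\cdots k_n}$ with $k=k_n$, its subintervals $I_{k_1\cdots k_n l}$, for those $l\geq 0$ with $k_1\cdots k_nl$ admissible, are defined as follows. Starting from the left endpoint of $I$, place mutually adjacent intervals $I_{k_1\cdots k_n\,k+1},I_{k_1\cdots k_n\,k+2},\dots$ from left to right, with $|I_{k_1\cdots k_n\,k+j}|=\frac{3}{\pi^2}\frac{|I|}{j^2}$ for $j\ge1$. If $k\ne0$, also place, starting from the right endpoint of $I$, mutually adjacent intervals $I_{k_1\cdots k_n\,k},I_{k_1\cdots k_n\,k-1},\dots,I_{k_1\cdots k_n\,0}$ from right to left, with $|I_{k_1\cdots k_n\,k}|=\frac{3}{\pi^2}\frac{|I|}{(2k)^2}$ and $|I_{k_1\cdots k_n\,k-j}|=\frac{3}{\pi^2}\frac{|I|}{j^2}$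 for $1\le j\le k$. Let $C_n$ be the family of all $I_{k_1\cdots k_n}$ with $k_1\cdots k_n$ admissible, and put $$\mathcal C:=\bigcap_{n\ge1}\bigcup_{I\in C_n}I .$$ **Dissipative points.** Let $\mathcal C_\infty$ be the set of all $x\in\mathcal C$ for which there is an admissible infinite sequence $(k_n)_{n\ge1}$ with $\bigcap_{n\ge1}I_{k_1\cdots k_n}=\{x\}$ and $\lim_{n\to\infty}k_n=\infty$. **The set function.** Let $\zeta(s)=\sum_{m\ge1}m^{-s}$. For $1/2<\alpha<1$ put $\mu_\alpha(I_0):=1$ and, recursively, for every admissible word $k_1\cdots k_n l$ (with $n\ge 0$, and $k=k_n$ as above), $$\mu_\alpha(I_{k_1\cdots k_n l}):=\frac{\mu_\alpha(I_{k_1\cdots k_n})}{2\zeta(2\alpha)}\cdot\begin{cases}\dfrac1{|l-k|^{2\alpha}}+\dfrac1{(l+k)^{2\alpha}} & l\ne0,\ l\neq k,\\[2mm] \dfrac1{k^{2\alpha}} & l=0,\\[2mm] \dfrac1{(2k)^{2\alpha}} & l=k.\end{cases}$$ **Corollary 2.4 (label transience).** For every $1/2<\alpha<1$, there is exactly one Borel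 measure on $\mathcal C$ (that is, one Borel measure on $\mathbb R$ for which $\mathbb R\setminus\mathcal C$ is a null set) that takes the values $\mu_\alpha(I_{k_1\cdots k_n})$ above on all the intervals $I_{k_1\cdots k_n}$ (including $I_0$). It is a probability measure, again denoted by $\mu_\alpha$, and it gives full mass to the set of dissipative points: $$\mu_\alpha(\mathcal C_\infty)=1.$$ -/

import Mathlib

open Set Filter MeasureTheory

namespace LabelCantor

/-- A finite word `k₁ k₂ … kₙ` of labels is stored with its *last* label first, as the list
`[kₙ, …, k₂, k₁]`. This is the last label `kₙ`; the empty word, which codes the unit interval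
`I₀ = [0,1)`, has label `0`. -/
def lastLabel : List ℕ → ℕ
  | [] => 0
  | l :: _ => l

/-- Admissible finite words: `k₁ ≠ 0`, and `kᵢ = 0` implies `kᵢ₊₁ ≠ 0`. (The empty word is admissible
and its label is `0`, so the first condition is a case of the second one.) -/
def Admissible : List ℕ → Prop
  | [] => True
  | l :: w => (lastLabel w = 0 → l ≠ 0) ∧ Admissible w

/-- The ratio `|I_{k₁ … kₙ l}| / |I_{k₁ … kₙ}|` for `kₙ = k`. (Not used for `k = l = 0`.) -/
noncomputable def relLength (k l : ℕ) : ℝ :=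
  if k < l then 3 / Real.pi ^ 2 / ((l : ℝ) - k) ^ 2
  else if l = k then 3 / Real.pi ^ 2 / (2 * (k : ℝ)) ^ 2
  else 3 / Real.pi ^ 2 / ((k : ℝ) - l) ^ 2

/-- The relative position, in `[0,1)`, of the left endpoint of `I_{k₁ … kₙ l}` in `I_{k₁ … kₙ}`,
for `kₙ = k`. For `l > k` the children `k+1, …, l-1` are laid down, in this order, from the left
endpoint on; for `l ≤ k` the children `k, k-1, …, l` are laid down, in this order,
from the right endpoint leftwards. -/
noncomputable def relLeft (k l : ℕ) : ℝ :=
  if k < l then ∑ j ∈ Finset.Ioo k l, relLength k j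
  else 1 - ∑ j ∈ Finset.Icc l k, relLength k j

/-- The length of the fundamental interval of a word. -/
noncomputable def len : List ℕ → ℝ
  | [] => 1
  | l :: w => len w * relLength (lastLabel w) l

/-- The left endpoint of the fundamental interval of a word. -/
noncomputable def left : List ℕ → ℝ
  | [] => 0
  | l :: w => left w + len w * relLeft (lastLabel w) l

/-- The fundamental interval `I_{k₁ … kₙ}`, closed on the left and open on the right. -/
noncomputable def interval (w : List ℕ) : Set ℝ :=
  Ico (left w) (left w + len w)

/-- The family `Cₙ` of the fundamental intervals of level `n`. -/
def level (n : ℕ) : Set (Set ℝ) :=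
  {I | ∃ w : List ℕ, w.length = n ∧ Admissible w ∧ I = interval w}

/-- The Cantor-like set `𝒞`. -/
def cantor : Set ℝ :=
  ⋂ (n : ℕ) (_ : 1 ≤ n), ⋃ I ∈ level n, I

/-- The word `k₁ … kₙ` of the first `n` terms of a sequence, where `kᵢ₊₁` is written `k i`. -/
def initialWord (k : ℕ → ℕ) : ℕ → List ℕ
  | 0 => []
  | n + 1 => k n :: initialWord k n

/-- Admissible infinite sequences. -/
def AdmissibleSeq (k : ℕ → ℕ) : Prop :=
  ∀ n, Admissible (initialWord k n)

/-- The sequence `k` codes the point `x`: the intersection of the fundamental intervals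
`I_{k₁ … kₙ}`, `n ≥ 1`, is the singleton `{x}`. -/
def Codes (k : ℕ → ℕ) (x : ℝ) : Prop :=
  AdmissibleSeq k ∧ (⋂ n : ℕ, interval (initialWord k (n + 1))) = {x}

/-- The set `𝒞_∞` of dissipative points. -/
def dissipative : Set ℝ :=
  {x | x ∈ cantor ∧ ∃ k : ℕ → ℕ, Codes k x ∧ Tendsto k atTop atTop}

/-- The zeta function `∑_{m ≥ 1} m⁻ˢ` at a real argument `s > 1`. -/
noncomputable def zeta (s : ℝ) : ℝ :=
  ∑' m : ℕ, 1 / ((m : ℝ) + 1) ^ s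

/-- The ratio `μ_α(I_{k₁ … kₙ l}) / μ_α(I_{k₁ … kₙ})` for `kₙ = k`.
(Not used for `k = l = 0`.) -/
noncomputable def relMass (α : ℝ) (k l : ℕ) : ℝ :=
  if l = k then 1 / (2 * zeta (2 * α)) * (1 / (2 * (k : ℝ)) ^ (2 * α))
  else if l = 0 then 1 / (2 * zeta (2 * α)) * (1 / (k : ℝ) ^ (2 * α))
  else 1 / (2 * zeta (2 * α)) *
    (1 / |(l : ℝ) - k| ^ (2 * α) + 1 / ((l : ℝ) + k) ^ (2 * α))

/-- The set function `μ_α(I_{k₁ … kₙ})`, by recursion on the word, with `μ_α(I₀) = 1`. -/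
noncomputable def mass (α : ℝ) : List ℕ → ℝ
  | [] => 1
  | l :: w => mass α w * relMass α (lastLabel w) l

/-- `μ` is a Borel measure on `𝒞` (a Borel measure on the line carried by `𝒞`) that takes the
recursively prescribed values on all fundamental intervals. -/
def IsLabelMeasure (α : ℝ) (μ : Measure ℝ) : Prop :=
  μ cantorᶜ = 0 ∧ ∀ w : List ℕ, Admissible w → μ (interval w) = ENNReal.ofReal (mass α w)

end LabelCantor

namespace LabelCantor

/-! ### Geometry of the fundamental intervals -/

/-! Read as transition probabilities, the ratios `relMass α k l` define a Markov chain of labels: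
the absolute value of the symmetric random walk on ℤ whose jump x has probability proportional to
|x|^(-2α). Folding turns characters into cosines, so cos(lθ), as a function of the label l, is an
eigenfunction with eigenvalue φ(θ) = `charFn α θ` (`hasSum_relMass_mul_cos`). Fourier inversion on
[0, π] then recovers the law of the n-th label from cos(jθ) φ(θ)^n (`chain_real_mul`). The heavy
tail gives 1 - φ(θ) ≥ c θ^(2α-1) (`le_one_sub_charFn`). For α < 1 the reciprocal is integrable at 0,
so every label has finitely many expected visits, and by Borel–Cantelli the labels tend to infinity
(`chain_tendsto`).

A label sequence tending to infinity codes a point that lies in all its half-open intervals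
(`point_mem_interval`). Pushing the law of the chain forward under `point` therefore gives a measure
with the prescribed values that is carried by the dissipative points. For uniqueness, an open set
meets the Cantor set in an increasing union over levels of disjoint fundamental intervals, so the
masses determine the measure of every open set. -/

lemma three_div_pi_sq_pos : 0 < 3 / Real.pi ^ 2 := by positivity

lemma three_div_pi_sq_lt_one : 3 / Real.pi ^ 2 < 1 := by
  rw [div_lt_one (by positivity)]
  nlinarith [Real.pi_gt_three]

/-- The constant 3/π² is 1/(2ζ(2)): distinct denominators use up at most half of the parent. -/
lemma sum_le_half {s : Finset ℕ} {f : ℕ → ℝ} {φ : ℕ → ℕ} (hφ : Set.InjOn φ s)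
    (hf : ∀ i ∈ s, f i ≤ 3 / Real.pi ^ 2 / (φ i : ℝ) ^ 2) : ∑ i ∈ s, f i ≤ 1 / 2 := by
  calc ∑ i ∈ s, f i ≤ ∑ i ∈ s, 3 / Real.pi ^ 2 / (φ i : ℝ) ^ 2 := Finset.sum_le_sum hf
    _ = ∑ j ∈ s.image φ, 3 / Real.pi ^ 2 * (1 / (j : ℝ) ^ 2) := by
        rw [Finset.sum_image hφ]
        exact Finset.sum_congr rfl fun i _ => by ring
    _ ≤ 3 / Real.pi ^ 2 * (Real.pi ^ 2 / 6) := by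
        rw [← Finset.mul_sum]
        gcongr
        exact sum_le_hasSum _ (fun i _ => by positivity) hasSum_zeta_two
    _ = 1 / 2 := by field_simp; norm_num

lemma relLength_of_lt {k l : ℕ} (h : k < l) :
    relLength k l = 3 / Real.pi ^ 2 / ((l - k : ℕ) : ℝ) ^ 2 := by
  rw [relLength, if_pos h, Nat.cast_sub h.le]

lemma relLength_self (k : ℕ) : relLength k k = 3 / Real.pi ^ 2 / (2 * (k : ℝ)) ^ 2 := by
  simp [relLength]

lemma relLength_of_gt {k l : ℕ} (h : l < k) :
    relLength k l = 3 / Real.pi ^ 2 / ((k - l : ℕ) : ℝ) ^ 2 := by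
  rw [relLength, if_neg h.not_gt, if_neg h.ne, Nat.cast_sub h.le]

lemma relLength_nonneg (k l : ℕ) : 0 ≤ relLength k l := by
  unfold relLength
  split_ifs <;> positivity

lemma exists_relLength_eq {k l : ℕ} (h : k = 0 → l ≠ 0) :
    ∃ d : ℕ, 1 ≤ d ∧ relLength k l = 3 / Real.pi ^ 2 / (d : ℝ) ^ 2 := by
  rcases lt_trichotomy k l with hl | rfl | hl
  · exact ⟨l - k, by omega, relLength_of_lt hl⟩
  · exact ⟨2 * k, by omega, by rw [relLength_self]; push_cast; rfl⟩
  · exact ⟨k - l, by omega, relLength_of_gt hl⟩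

lemma relLength_pos {k l : ℕ} (h : k = 0 → l ≠ 0) : 0 < relLength k l := by
  obtain ⟨d, hd, e⟩ := exists_relLength_eq h
  rw [e]
  positivity

lemma relLength_le {k l : ℕ} (h : k = 0 → l ≠ 0) : relLength k l ≤ 3 / Real.pi ^ 2 := by
  obtain ⟨d, hd, e⟩ := exists_relLength_eq h
  rw [e]
  refine div_le_self three_div_pi_sq_pos.le ?_
  have : (1 : ℝ) ≤ d := by exact_mod_cast hd
  exact one_le_pow₀ this

lemma sum_Ioc_relLength_le (k l : ℕ) : ∑ j ∈ Finset.Ioc k l, relLength k j ≤ 1 / 2 := by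
  refine sum_le_half (φ := fun j => j - k) ?_ fun j hj => ?_
  · intro a ha b hb hab
    simp only [Finset.coe_Ioc, Set.mem_Ioc] at ha hb hab
    omega
  · exact (relLength_of_lt (Finset.mem_Ioc.1 hj).1).le

lemma sum_Icc_relLength_le {k : ℕ} (hk : k ≠ 0) (l : ℕ) :
    ∑ j ∈ Finset.Icc l k, relLength k j ≤ 1 / 2 := by
  -- The children j < k use the denominators 1, …, k. The child k gets the unused k + 1, which is at
  -- most 2k.
  refine sum_le_half (φ := fun j => if j = k then k + 1 else k - j) ?_ fun j hj => ?_
  · intro a ha b hb hab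
    simp only [Finset.coe_Icc, Set.mem_Icc] at ha hb hab
    split_ifs at hab <;> omega
  · rcases (Finset.mem_Icc.1 hj).2.lt_or_eq with h | rfl
    · simp only [h.ne, if_false]
      exact (relLength_of_gt h).le
    · simp only [if_true]
      rw [relLength_self]
      have : (1 : ℝ) ≤ j := by exact_mod_cast Nat.one_le_iff_ne_zero.2 hk
      gcongr
      push_cast
      linarith

lemma relLeft_add_relLength_of_lt {k l : ℕ} (h : k < l) :
    relLeft k l + relLength k l = ∑ j ∈ Finset.Ioc k l, relLength k j := by
  rw [relLeft, if_pos h, ← Finset.Ioo_insert_right h, Finset.sum_insert (by simp), add_comm]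

lemma relLeft_add_relLength_of_le {k l : ℕ} (h : l ≤ k) :
    relLeft k l + relLength k l = 1 - ∑ j ∈ Finset.Ioc l k, relLength k j := by
  rw [relLeft, if_neg h.not_gt, ← Finset.Ioc_insert_left h, Finset.sum_insert (by simp)]
  ring

lemma relLeft_add_relLength_le_half {k l : ℕ} (h : k < l) :
    relLeft k l + relLength k l ≤ 1 / 2 :=
  (relLeft_add_relLength_of_lt h).trans_le (sum_Ioc_relLength_le k l)

lemma relLeft_add_relLength_le_one (k l : ℕ) : relLeft k l + relLength k l ≤ 1 := by
  rcases lt_or_ge k l with h | h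
  · linarith [relLeft_add_relLength_le_half h]
  · rw [relLeft_add_relLength_of_le h]
    linarith [Finset.sum_nonneg fun j (_ : j ∈ Finset.Ioc l k) => relLength_nonneg k j]

lemma half_le_relLeft {k l : ℕ} (hk : k ≠ 0) (h : l ≤ k) : 1 / 2 ≤ relLeft k l := by
  rw [relLeft, if_neg h.not_gt]
  linarith [sum_Icc_relLength_le hk l]

lemma relLeft_nonneg {k l : ℕ} (h : k = 0 → l ≠ 0) : 0 ≤ relLeft k l := by
  rcases lt_or_ge k l with hl | hl
  · rw [relLeft, if_pos hl]
    exact Finset.sum_nonneg fun j _ => relLength_nonneg k j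
  · linarith [half_le_relLeft (k := k) (l := l) (by omega) hl]

/-- Children with label above k lie in the left half of the parent and the others in the right half.
Within one half the partial sums are nested. -/
lemma relLeft_separated {k l m : ℕ} (hl : k = 0 → l ≠ 0) (hm : k = 0 → m ≠ 0) (h : l < m) :
    relLeft k l + relLength k l ≤ relLeft k m ∨ relLeft k m + relLength k m ≤ relLeft k l := by
  rcases lt_or_ge k l with h1 | h1
  · left
    rw [relLeft_add_relLength_of_lt h1, relLeft, if_pos (h1.trans h)]
    refine Finset.sum_le_sum_of_subset_of_nonneg ?_ fun j _ _ => relLength_nonneg k j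
    intro j
    simp only [Finset.mem_Ioc, Finset.mem_Ioo]
    omega
  · rcases lt_or_ge k m with h2 | h2
    · right
      linarith [half_le_relLeft (k := k) (l := l) (by omega) h1, relLeft_add_relLength_le_half h2]
    · left
      rw [relLeft_add_relLength_of_le h1, relLeft, if_neg h2.not_gt]
      refine sub_le_sub_left (Finset.sum_le_sum_of_subset_of_nonneg ?_
        fun j _ _ => relLength_nonneg k j) _
      intro j
      simp only [Finset.mem_Icc, Finset.mem_Ioc]
      omega

/-! ### Nesting, disjointness and shrinking of the fundamental intervals -/

lemma len_pos {w : List ℕ} (hw : Admissible w) : 0 < len w := by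
  induction w with
  | nil => exact one_pos
  | cons l w ih => exact mul_pos (ih hw.2) (relLength_pos hw.1)

lemma len_le {w : List ℕ} (hw : Admissible w) : len w ≤ (3 / Real.pi ^ 2) ^ w.length := by
  induction w with
  | nil => simp [len]
  | cons l w ih =>
    rw [len, List.length_cons, pow_succ]
    exact mul_le_mul (ih hw.2) (relLength_le hw.1) (relLength_nonneg _ _) (by positivity)

lemma left_le_left_cons {l : ℕ} {w : List ℕ} (h : Admissible (l :: w)) :
    left w ≤ left (l :: w) := by
  rw [left]
  linarith [mul_nonneg (len_pos h.2).le (relLeft_nonneg h.1)]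

lemma right_cons (l : ℕ) (w : List ℕ) : left (l :: w) + len (l :: w) =
    left w + len w * (relLeft (lastLabel w) l + relLength (lastLabel w) l) := by
  rw [left, len]
  ring

lemma right_cons_le {l : ℕ} {w : List ℕ} (h : Admissible (l :: w)) :
    left (l :: w) + len (l :: w) ≤ left w + len w := by
  rw [right_cons]
  nlinarith [relLeft_add_relLength_le_one (lastLabel w) l, len_pos h.2]

lemma right_cons_lt {l : ℕ} {w : List ℕ} (h : Admissible (l :: w)) (hl : lastLabel w < l) :
    left (l :: w) + len (l :: w) < left w + len w := by
  rw [right_cons]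
  nlinarith [relLeft_add_relLength_le_half hl, len_pos h.2]

lemma interval_cons_subset {l : ℕ} {w : List ℕ} (h : Admissible (l :: w)) :
    interval (l :: w) ⊆ interval w :=
  Ico_subset_Ico (left_le_left_cons h) (right_cons_le h)

lemma interval_subset_unit {w : List ℕ} (h : Admissible w) : interval w ⊆ interval [] := by
  induction w with
  | nil => exact subset_rfl
  | cons l w ih => exact (interval_cons_subset h).trans (ih h.2)

lemma disjoint_interval_siblings {l m : ℕ} {w : List ℕ} (hl : Admissible (l :: w))
    (hm : Admissible (m :: w)) (hlm : l < m) : Disjoint (interval (l :: w)) (interval (m :: w)) := by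
  rw [Set.disjoint_left]
  intro x hx hx'
  simp only [interval, mem_Ico, right_cons] at hx hx'
  simp only [left] at hx hx'
  rcases relLeft_separated hl.1 hm.1 hlm with h | h
  · nlinarith [mul_le_mul_of_nonneg_left h (len_pos hl.2).le]
  · nlinarith [mul_le_mul_of_nonneg_left h (len_pos hl.2).le]

lemma disjoint_interval {w v : List ℕ} (hw : Admissible w) (hv : Admissible v)
    (hl : w.length = v.length) (hne : w ≠ v) : Disjoint (interval w) (interval v) := by
  induction w generalizing v with
  | nil => exact absurd (List.length_eq_zero_iff.1 hl.symm).symm hne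
  | cons l w ih =>
    cases v with
    | nil => simp at hl
    | cons m v =>
      by_cases h : w = v
      · subst h
        rcases lt_trichotomy l m with h | rfl | h
        · exact disjoint_interval_siblings hw hv h
        · exact absurd rfl hne
        · exact (disjoint_interval_siblings hv hw h).symm
      · exact (ih hw.2 hv.2 (by simpa using hl) h).mono (interval_cons_subset hw)
          (interval_cons_subset hv)

lemma measurableSet_interval (w : List ℕ) : MeasurableSet (interval w) := measurableSet_Ico

lemma cantor_eq : cantor = ⋂ (n : ℕ) (_ : 1 ≤ n), ⋃ w ∈ {w : List ℕ | w.length = n ∧ Admissible w},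
    interval w := by
  unfold cantor
  refine iInter_congr fun n => iInter_congr fun _ => ?_
  ext x
  simp only [level, mem_iUnion, mem_ofPred_eq, exists_prop]
  constructor
  · rintro ⟨_, ⟨w, h1, h2, rfl⟩, hx⟩
    exact ⟨w, ⟨h1, h2⟩, hx⟩
  · rintro ⟨w, ⟨h1, h2⟩, hx⟩
    exact ⟨_, ⟨w, h1, h2, rfl⟩, hx⟩

lemma measurableSet_cantor : MeasurableSet cantor := by
  rw [cantor_eq]
  exact MeasurableSet.iInter fun n => MeasurableSet.iInter fun _ =>
    MeasurableSet.biUnion (to_countable _) fun w _ => measurableSet_interval w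

lemma exists_word_of_mem_cantor {x : ℝ} (hx : x ∈ cantor) (n : ℕ) :
    ∃ w : List ℕ, w.length = n + 1 ∧ Admissible w ∧ x ∈ interval w := by
  rw [cantor_eq] at hx
  have := mem_iInter₂.1 hx (n + 1) (by omega)
  simp only [mem_iUnion, mem_ofPred_eq, exists_prop] at this
  obtain ⟨w, ⟨h1, h2⟩, h3⟩ := this
  exact ⟨w, h1, h2, h3⟩

/-! ### Points coded by label sequences -/

lemma length_initialWord (k : ℕ → ℕ) (n : ℕ) : (initialWord k n).length = n := by
  induction n with
  | zero => rfl
  | succ n ih => simp [initialWord, ih]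

/-- The point coded by a label sequence: the supremum of the left endpoints. -/
noncomputable def point (k : ℕ → ℕ) : ℝ := ⨆ n, left (initialWord k n)

lemma antitone_right {k : ℕ → ℕ} (hk : AdmissibleSeq k) :
    Antitone fun n => left (initialWord k n) + len (initialWord k n) :=
  antitone_nat_of_succ_le fun n => right_cons_le (hk (n + 1))

lemma monotone_left {k : ℕ → ℕ} (hk : AdmissibleSeq k) :
    Monotone fun n => left (initialWord k n) :=
  monotone_nat_of_le_succ fun n => left_le_left_cons (hk (n + 1))

lemma left_le_right {k : ℕ → ℕ} (hk : AdmissibleSeq k) (m n : ℕ) :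
    left (initialWord k m) ≤ left (initialWord k n) + len (initialWord k n) := by
  have h1 := monotone_left hk (le_max_left m n)
  have h2 := antitone_right hk (le_max_right m n)
  have h3 := len_pos (hk (max m n))
  simp only at h1 h2
  linarith

/-- Nested half-open intervals may shrink to a missing right endpoint. Labels tending to infinity
must increase infinitely often, and each increase selects a child in the left half, away from the
right endpoint. -/
lemma point_mem_interval {k : ℕ → ℕ} (hk : AdmissibleSeq k) (h : Tendsto k atTop atTop) (n : ℕ) :
    point k ∈ interval (initialWord k n) := by
  have hle (m : ℕ) : point k ≤ left (initialWord k m) + len (initialWord k m) :=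
    ciSup_le fun j => left_le_right hk j m
  refine ⟨le_ciSup (f := fun n => left (initialWord k n))
    ⟨_, forall_mem_range.2 fun j => left_le_right hk j 0⟩ n, ?_⟩
  have hm : ∃ m ≥ n, k m < k (m + 1) := by
    by_contra! hcon
    have hanti : ∀ j ≥ n, k j ≤ k n := fun j hj =>
      Nat.le_induction le_rfl (fun i hi hi' => (hcon i hi).trans hi') j hj
    obtain ⟨j, hj1, hj2⟩ := ((h.eventually_gt_atTop (k n)).and (eventually_ge_atTop n)).exists
    exact absurd (hanti j hj2) hj1.not_ge
  obtain ⟨m, hm, hlt⟩ := hm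
  -- `initialWord k (m + 2)` appends `k (m + 1)` to a word with last label `k m`, so this is the
  -- level of the increase.
  calc point k ≤ _ := hle (m + 2)
    _ < left (initialWord k (m + 1)) + len (initialWord k (m + 1)) :=
        right_cons_lt (hk (m + 2)) hlt
    _ ≤ _ := antitone_right hk (by omega : n ≤ m + 1)

lemma tendsto_len {k : ℕ → ℕ} (hk : AdmissibleSeq k) :
    Tendsto (fun n => len (initialWord k n)) atTop (nhds 0) := by
  refine squeeze_zero (fun n => (len_pos (hk n)).le) (fun n => ?_)
    (tendsto_pow_atTop_nhds_zero_of_lt_one three_div_pi_sq_pos.le three_div_pi_sq_lt_one)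
  simpa only [length_initialWord] using len_le (hk n)

lemma codes_point {k : ℕ → ℕ} (hk : AdmissibleSeq k) (h : Tendsto k atTop atTop) :
    Codes k (point k) := by
  refine ⟨hk, Subset.antisymm (fun y hy => ?_) (singleton_subset_iff.2 <|
    mem_iInter.2 fun n => point_mem_interval hk h (n + 1))⟩
  rw [mem_iInter] at hy
  have key : |y - point k| ≤ 0 := by
    refine ge_of_tendsto ((tendsto_add_atTop_iff_nat 1).2 (tendsto_len hk))
      (Eventually.of_forall fun n => ?_)
    have h1 := hy n
    have h2 := point_mem_interval hk h (n + 1)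
    simp only [interval, mem_Ico] at h1 h2
    rw [abs_le]
    constructor <;> linarith
  exact sub_eq_zero.1 (abs_nonpos_iff.1 key)

lemma point_mem_dissipative {k : ℕ → ℕ} (hk : AdmissibleSeq k) (h : Tendsto k atTop atTop) :
    point k ∈ dissipative := by
  refine ⟨?_, k, codes_point hk h, h⟩
  rw [cantor_eq]
  refine mem_iInter₂.2 fun n _ => mem_iUnion₂.2 ⟨initialWord k n, ?_, point_mem_interval hk h n⟩
  exact ⟨length_initialWord k n, hk n⟩

/-! ### The symmetric random walk on `ℤ` and its folding to `ℕ` -/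

/-- The jump distribution of the symmetric random walk on `ℤ` whose absolute value is the
label chain. -/
noncomputable def jump (α : ℝ) (x : ℤ) : ℝ :=
  1 / (2 * zeta (2 * α)) * (1 / |(x : ℝ)| ^ (2 * α))

/-- The characteristic function of the jump distribution. -/
noncomputable def charFn (α θ : ℝ) : ℝ := ∑' x : ℤ, jump α x * Real.cos (x * θ)

lemma hasSum_zeta {s : ℝ} (hs : 1 < s) :
    HasSum (fun m : ℕ => 1 / ((m : ℝ) + 1) ^ s) (zeta s) := by
  have h := (summable_nat_add_iff 1).2 (Real.summable_one_div_nat_rpow.2 hs)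
  simpa only [zeta, Nat.cast_add, Nat.cast_one] using h.hasSum

lemma zeta_pos {s : ℝ} (hs : 1 < s) : 0 < zeta s :=
  (hasSum_zeta hs).summable.tsum_pos (fun m => by positivity) 0 (by norm_num)

variable {α : ℝ}

lemma jump_neg (x : ℤ) : jump α (-x) = jump α x := by simp [jump]

lemma jump_zero (hα : 1 / 2 < α) : jump α 0 = 0 := by
  have : 2 * α ≠ 0 := by linarith
  simp [jump, Real.zero_rpow this]

lemma jump_nonneg (hα : 1 / 2 < α) (x : ℤ) : 0 ≤ jump α x := by
  have := zeta_pos (s := 2 * α) (by linarith)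
  unfold jump
  positivity

lemma hasSum_jump (hα : 1 / 2 < α) : HasSum (jump α) 1 := by
  have hz := hasSum_zeta (s := 2 * α) (by linarith)
  have hp := zeta_pos (s := 2 * α) (by linarith)
  have h1 : HasSum (fun m : ℕ => jump α (m + 1)) (1 / 2) := by
    have := hz.mul_left (1 / (2 * zeta (2 * α)))
    have e : 1 / (2 * zeta (2 * α)) * zeta (2 * α) = 1 / 2 := by field_simp
    rw [e] at this
    refine this.congr_fun fun m => ?_
    have : |((m : ℝ) + 1)| = m + 1 := abs_of_nonneg (by positivity)
    simp [jump, this]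
  have h2 : HasSum (fun m : ℕ => jump α (-(m + 1 : ℤ))) (1 / 2) := by simpa only [jump_neg] using h1
  have := HasSum.of_add_one_of_neg_add_one h1 h2
  rw [jump_zero hα] at this
  convert this using 1
  norm_num

/-- A label l ≠ 0 is reached by the walk from k at both l and -l, the label 0 at one site only. The
case l = k fits in because `jump α 0` is 0, division by zero being 0. -/
lemma relMass_eq (hα : 1 / 2 < α) (k l : ℕ) :
    relMass α k l = if l = 0 then jump α k else jump α (l - k) + jump α (l + k) := by
  have h0 : 2 * α ≠ 0 := by linarith
  have hk : |(k : ℝ)| = k := abs_of_nonneg (by positivity)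
  have hlk : |(l : ℝ) + k| = l + k := abs_of_nonneg (by positivity)
  unfold relMass
  split_ifs with h1 h2 h2
  · subst h2
    subst h1
    simp [jump, Real.zero_rpow h0]
  · subst h1
    rw [sub_self, jump_zero hα]
    simp [jump, hlk, two_mul]
  · simp [jump]
  · simp only [jump]
    push_cast
    rw [hlk]
    ring

lemma relMass_nonneg (hα : 1 / 2 < α) (k l : ℕ) : 0 ≤ relMass α k l := by
  rw [relMass_eq hα]
  split_ifs
  · exact jump_nonneg hα _
  · exact add_nonneg (jump_nonneg hα _) (jump_nonneg hα _)

lemma relMass_zero_zero (hα : 1 / 2 < α) : relMass α 0 0 = 0 := by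
  simp [relMass_eq hα, jump_zero hα]

lemma hasSum_relMass_mul (hα : 1 / 2 < α) (k : ℕ) {f : ℤ → ℝ} (hf : ∀ x, f (-x) = f x) {m : ℝ}
    (h : HasSum (fun x : ℤ => jump α (x - k) * f x) m) :
    HasSum (fun l : ℕ => relMass α k l * f l) m := by
  -- Pairing x with -x counts the site 0 twice; one copy is removed.
  have h1 := h.nat_add_neg.sub (hasSum_ite_eq (0 : ℕ) (jump α (0 - k) * f 0))
  rw [add_sub_cancel_right] at h1
  refine h1.congr_fun fun l => ?_
  have e (x : ℤ) : jump α (-x - k) = jump α (x + k) := by rw [← jump_neg]; congr 1; ring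
  simp only [relMass_eq hα, hf, e]
  split_ifs with hl
  · subst hl
    have : jump α (0 - k) = jump α k := by rw [zero_sub, jump_neg]
    simp only [Nat.cast_zero, this, zero_add]
    ring
  · ring

lemma hasSum_relMass (hα : 1 / 2 < α) (k : ℕ) : HasSum (relMass α k) 1 := by
  have h : HasSum (fun x : ℤ => jump α (x - k) * 1) 1 := by
    simpa [Function.comp_def] using
      ((Equiv.subRight (k : ℤ)).hasSum_iff (f := jump α)).2 (hasSum_jump hα)
  simpa using hasSum_relMass_mul hα k (f := fun _ => 1) (fun _ => rfl) h

lemma summable_jump_mul (hα : 1 / 2 < α) {f : ℤ → ℝ} (hf : ∀ x, |f x| ≤ 1) :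
    Summable fun x : ℤ => jump α x * f x := by
  refine Summable.of_norm_bounded (hasSum_jump hα).summable fun x => ?_
  rw [norm_mul, Real.norm_of_nonneg (jump_nonneg hα x)]
  exact mul_le_of_le_one_right (jump_nonneg hα x) (hf x)

lemma hasSum_charFn (hα : 1 / 2 < α) (θ : ℝ) :
    HasSum (fun x : ℤ => jump α x * Real.cos (x * θ)) (charFn α θ) :=
  (summable_jump_mul hα fun _ => Real.abs_cos_le_one _).hasSum

lemma hasSum_relMass_mul_cos (hα : 1 / 2 < α) (k : ℕ) (θ : ℝ) :
    HasSum (fun l : ℕ => relMass α k l * Real.cos (l * θ)) (charFn α θ * Real.cos (k * θ)) := by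
  have key : HasSum (fun x : ℤ => jump α x * Real.cos ((x + k) * θ))
      (charFn α θ * Real.cos (k * θ)) := by
    have h1 := (summable_jump_mul (f := fun x : ℤ => Real.cos ((x + k) * θ)) hα
      fun _ => Real.abs_cos_le_one _).hasSum
    -- Averaging over x and -x cancels the sine terms of the addition formula.
    have h2 := ((Equiv.neg ℤ).hasSum_iff).2 h1
    have h3 := h1.add h2
    have h4 := ((hasSum_charFn hα θ).mul_right (Real.cos (k * θ))).mul_left 2
    have e := h3.unique (h4.congr_fun fun x => ?_)
    · convert h1 using 1
      linarith
    · simp only [Function.comp_apply, Equiv.neg_apply, jump_neg, Int.cast_neg, neg_mul, add_mul,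
        Real.cos_add, Real.cos_neg, Real.sin_neg]
      ring
  have h := ((Equiv.subRight (k : ℤ)).hasSum_iff).2 key
  refine hasSum_relMass_mul hα k (f := fun x : ℤ => Real.cos (x * θ)) (fun x => by simp) ?_
  simpa [Function.comp_def] using h

lemma abs_charFn_le_one (hα : 1 / 2 < α) (θ : ℝ) : |charFn α θ| ≤ 1 := by
  refine (hasSum_charFn hα θ).norm_le_of_bounded (hasSum_jump hα) fun x => ?_
  rw [norm_mul, Real.norm_of_nonneg (jump_nonneg hα x)]
  exact mul_le_of_le_one_right (jump_nonneg hα x) (Real.abs_cos_le_one _)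

lemma continuous_charFn (hα : 1 / 2 < α) : Continuous (charFn α) := by
  refine continuous_tsum (fun x => by fun_prop) (hasSum_jump hα).summable fun x θ => ?_
  rw [norm_mul, Real.norm_of_nonneg (jump_nonneg hα x)]
  exact mul_le_of_le_one_right (jump_nonneg hα x) (Real.abs_cos_le_one _)

/-! ### Decay of 1 - φ at 0 and the Green function bound -/

lemma cube_div_three_le_sum_sq (N : ℕ) :
    (N : ℝ) ^ 3 / 3 ≤ ∑ j ∈ Finset.range N, ((j : ℝ) + 1) ^ 2 := by
  induction N with
  | zero => simp
  | succ N ih =>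
    rw [Finset.sum_range_succ]
    push_cast
    nlinarith [(Nat.cast_nonneg N : (0 : ℝ) ≤ N)]

/-- Only the jumps 1, …, N with N = ⌊π/θ⌋ are kept. There the jump weight is at least its value at u
= π/θ, and 1 - cos y ≥ 2y²/π². The sum of squares contributes u³/24, since N ≥ u/2. -/
lemma le_one_sub_charFn (hα : 1 / 2 < α) {θ : ℝ} (h0 : 0 < θ) (hπ : θ ≤ Real.pi) :
    1 / (24 * zeta (2 * α)) * (θ / Real.pi) ^ (2 * α - 1) ≤ 1 - charFn α θ := by
  have hz := zeta_pos (s := 2 * α) (by linarith)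
  have hpi := Real.pi_pos
  set u : ℝ := Real.pi / θ with hu
  have hu1 : 1 ≤ u := (one_le_div h0).2 hπ
  have hu0 : 0 < u := by positivity
  set N := ⌊u⌋₊ with hN
  have hNu : (N : ℝ) ≤ u := Nat.floor_le hu0.le
  have hN2 : u / 2 ≤ N := by
    have h1 : (1 : ℝ) ≤ N := by exact_mod_cast Nat.one_le_floor_iff _ |>.2 hu1
    have := Nat.lt_floor_add_one u
    rw [← hN] at this
    linarith
  have hs : HasSum (fun x : ℤ => jump α x * (1 - Real.cos (x * θ))) (1 - charFn α θ) := by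
    simpa only [mul_sub, mul_one] using (hasSum_jump hα).sub (hasSum_charFn hα θ)
  have hinj : Set.InjOn (fun j : ℕ => (j : ℤ) + 1) (Finset.range N) := fun a _ b _ h => by
    simpa using h
  have hle := sum_le_hasSum ((Finset.range N).image fun j : ℕ => (j : ℤ) + 1)
    (fun x _ => mul_nonneg (jump_nonneg hα x) (sub_nonneg.2 (Real.cos_le_one _))) hs
  rw [Finset.sum_image hinj] at hle
  refine le_trans ?_ hle
  have hterm : ∀ j ∈ Finset.range N, 1 / (2 * zeta (2 * α)) * (u ^ (2 * α))⁻¹ * (2 / u ^ 2) *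
      ((j : ℝ) + 1) ^ 2 ≤ jump α ((j : ℤ) + 1) * (1 - Real.cos (((j : ℤ) + 1 : ℤ) * θ)) := by
    intro j hj
    have hjN : (j : ℝ) + 1 ≤ u := by
      have : ((j + 1 : ℕ) : ℝ) ≤ N := by exact_mod_cast Finset.mem_range.1 hj
      push_cast at this
      linarith
    have hθ : ((j : ℝ) + 1) * θ ≤ Real.pi := by
      rw [hu, le_div_iff₀ h0] at hjN
      exact hjN
    have hcos := Real.cos_le_one_sub_mul_cos_sq (x := ((j : ℝ) + 1) * θ) (by
      rw [abs_of_nonneg (by positivity)]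
      exact hθ)
    have e : 2 / Real.pi ^ 2 * (((j : ℝ) + 1) * θ) ^ 2 = 2 / u ^ 2 * ((j : ℝ) + 1) ^ 2 := by
      rw [hu]
      field_simp
    rw [e] at hcos
    rw [mul_assoc]
    push_cast
    refine mul_le_mul ?_ (by linarith) (by positivity) (jump_nonneg hα _)
    rw [jump, one_div (_ ^ _)]
    push_cast
    rw [abs_of_nonneg (by positivity : (0 : ℝ) ≤ (j : ℝ) + 1)]
    gcongr
  refine le_trans ?_ (Finset.sum_le_sum hterm)
  rw [← Finset.mul_sum]
  have hcube : u ^ 3 / 24 ≤ ∑ j ∈ Finset.range N, ((j : ℝ) + 1) ^ 2 := by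
    refine le_trans ?_ (cube_div_three_le_sum_sq N)
    have : (u / 2) ^ 3 ≤ (N : ℝ) ^ 3 := by gcongr
    linarith [this, (by ring : (u / 2) ^ 3 = u ^ 3 / 8)]
  refine le_trans (le_of_eq ?_) (mul_le_mul_of_nonneg_left hcube (by positivity))
  have e : θ / Real.pi = u⁻¹ := by rw [hu, inv_div]
  rw [e, Real.inv_rpow hu0.le, Real.rpow_sub_one hu0.ne']
  have : 0 < u ^ (2 * α) := by positivity
  field_simp

lemma geom_sum_charFn_le (hα : 1 / 2 < α) {θ : ℝ} (h0 : 0 < θ) (hπ : θ ≤ Real.pi) (N x : ℕ) :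
    ∑ n ∈ Finset.range N, Real.cos (x * θ) * charFn α θ ^ n ≤
      48 * zeta (2 * α) * Real.pi ^ (2 * α - 1) * θ ^ (1 - 2 * α) := by
  have hz := zeta_pos (s := 2 * α) (by linarith)
  have hpi := Real.pi_pos
  have hl := le_one_sub_charFn hα h0 hπ
  set φ := charFn α θ
  have hφ := abs_charFn_le_one hα θ
  have hpos : 0 < 1 / (24 * zeta (2 * α)) * (θ / Real.pi) ^ (2 * α - 1) := by positivity
  have hd : 0 < 1 - φ := hpos.trans_le hl
  have hsum : ∑ n ∈ Finset.range N, φ ^ n = (1 - φ ^ N) / (1 - φ) := by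
    rw [eq_div_iff hd.ne', geom_sum_mul_neg]
  rw [← Finset.mul_sum, hsum]
  -- This crude bound is uniform in N and turns the constant 24 into 48.
  have hnum : |1 - φ ^ N| ≤ 2 := by
    have : |φ ^ N| ≤ 1 := by
      rw [abs_pow]
      exact pow_le_one₀ (abs_nonneg _) hφ
    rw [abs_le] at this ⊢
    constructor <;> linarith
  calc _ ≤ |Real.cos (x * θ) * ((1 - φ ^ N) / (1 - φ))| := le_abs_self _
    _ = |Real.cos (x * θ)| * (|1 - φ ^ N| / (1 - φ)) := by rw [abs_mul, abs_div, abs_of_pos hd]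
    _ ≤ 1 * (2 / (1 / (24 * zeta (2 * α)) * (θ / Real.pi) ^ (2 * α - 1))) := by
        gcongr
        exact Real.abs_cos_le_one _
    _ = _ := by
        rw [Real.div_rpow h0.le hpi.le, (by ring : 1 - 2 * α = -(2 * α - 1)), Real.rpow_neg h0.le]
        have : 0 < θ ^ (2 * α - 1) := by positivity
        field_simp
        norm_num

/-- The Fourier coefficients of the powers of `charFn` have bounded partial sums: this is where
`α < 1` enters. -/
lemma exists_sum_integral_le (hα : 1 / 2 < α) (hα' : α < 1) : ∃ C : ℝ, ∀ x N : ℕ,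
    ∑ n ∈ Finset.range N, ∫ θ in (0 : ℝ)..Real.pi, Real.cos (x * θ) * charFn α θ ^ n ≤ C := by
  refine ⟨∫ θ in (0 : ℝ)..Real.pi,
    48 * zeta (2 * α) * Real.pi ^ (2 * α - 1) * θ ^ (1 - 2 * α), fun x N => ?_⟩
  have hc := continuous_charFn hα
  have hi (n : ℕ) : IntervalIntegrable (fun θ => Real.cos (x * θ) * charFn α θ ^ n) volume 0
      Real.pi := (by fun_prop : Continuous _).intervalIntegrable _ _
  rw [← intervalIntegral.integral_finsetSum fun n _ => hi n]
  -- The open interval matters: at θ = 0 the majorant takes the default value 0.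
  refine intervalIntegral.integral_mono_on_of_le_Ioo Real.pi_pos.le
    ((by fun_prop : Continuous _).intervalIntegrable _ _)
    -- Integrability at 0 requires 1 - 2α > -1.
    ((intervalIntegral.intervalIntegrable_rpow' (by linarith)).const_mul _) fun θ hθ => ?_
  exact geom_sum_charFn_le hα hθ.1 hθ.2.le N x

lemma integral_cos_mul_cos (x k : ℕ) :
    ∫ θ in (0 : ℝ)..Real.pi, Real.cos (x * θ) * Real.cos (k * θ) =
      if k = x then (if x = 0 then Real.pi else Real.pi / 2) else 0 := by
  have hz (m : ℤ) : ∫ θ in (0 : ℝ)..Real.pi, Real.cos (m * θ) = if m = 0 then Real.pi else 0 := by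
    split_ifs with hm
    · simp [hm]
    · rw [intervalIntegral.integral_comp_mul_left (fun y => Real.cos y) (by exact_mod_cast hm)]
      simp [integral_cos, Real.sin_int_mul_pi]
  have e (θ : ℝ) : Real.cos (x * θ) * Real.cos (k * θ) =
      1 / 2 * Real.cos (((x - k : ℤ) : ℝ) * θ) + 1 / 2 * Real.cos (((x + k : ℤ) : ℝ) * θ) := by
    push_cast
    rw [sub_mul, add_mul, Real.cos_sub, Real.cos_add]
    ring
  simp only [e]
  rw [intervalIntegral.integral_add
    ((by fun_prop : Continuous _).intervalIntegrable _ _)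
    ((by fun_prop : Continuous _).intervalIntegrable _ _),
    intervalIntegral.integral_const_mul, intervalIntegral.integral_const_mul, hz, hz]
  split_ifs <;> first | omega | ring

/-! ### The label chain -/

/-- The one-step transition law of the label chain. -/
noncomputable def stepPMF (hα : 1 / 2 < α) (k : ℕ) : PMF ℕ :=
  ⟨fun l => ENNReal.ofReal (relMass α k l), by
    have h := hasSum_relMass hα k
    rw [ENNReal.summable.hasSum_iff, ← ENNReal.ofReal_tsum_of_nonneg (relMass_nonneg hα k)
      h.summable, h.tsum_eq, ENNReal.ofReal_one]⟩

lemma stepPMF_apply (hα : 1 / 2 < α) (k l : ℕ) :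
    stepPMF hα k l = ENNReal.ofReal (relMass α k l) := rfl

/-- The one-step transition kernel, as a kernel on histories. -/
noncomputable def stepKernel (hα : 1 / 2 < α) (b : ℕ) :
    ProbabilityTheory.Kernel (Finset.Iic b → ℕ) ℕ :=
  (ProbabilityTheory.Kernel.ofFunOfCountable fun k => (stepPMF hα k).toMeasure).comap
    (fun h => h ⟨b, Finset.mem_Iic.2 le_rfl⟩) (measurable_pi_apply _)

lemma stepKernel_apply (hα : 1 / 2 < α) (b : ℕ) (h : Finset.Iic b → ℕ) :
    stepKernel hα b h = (stepPMF hα (h ⟨b, Finset.mem_Iic.2 le_rfl⟩)).toMeasure := rfl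

instance (hα : 1 / 2 < α) (b : ℕ) : ProbabilityTheory.IsMarkovKernel (stepKernel hα b) :=
  ⟨fun h => by rw [stepKernel_apply]; infer_instance⟩

/-- The law of the label chain started at `0`. -/
noncomputable def chain (hα : 1 / 2 < α) : Measure (ℕ → ℕ) :=
  ProbabilityTheory.Kernel.traj (X := fun _ => ℕ) (stepKernel hα) 0 fun _ => 0

instance (hα : 1 / 2 < α) : IsProbabilityMeasure (chain hα) := by
  unfold chain
  infer_instance

lemma chain_zero (hα : 1 / 2 < α) : ∀ᵐ x ∂chain hα, x 0 = 0 := by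
  have h := ProbabilityTheory.Kernel.traj_map_frestrictLe_apply (X := fun _ => ℕ)
    (κ := stepKernel hα) 0 0 fun _ => 0
  rw [ProbabilityTheory.Kernel.partialTraj_self, ProbabilityTheory.Kernel.id_apply] at h
  refine ae_of_ae_map (p := fun y : Finset.Iic 0 → ℕ => y ⟨0, by simp⟩ = 0)
    (Preorder.measurable_frestrictLe (X := fun _ => ℕ) 0).aemeasurable ?_
  change ∀ᵐ y ∂(Measure.map _ (ProbabilityTheory.Kernel.traj _ _ _)), _
  rw [h, ae_dirac_iff (to_countable _).measurableSet]

/-- The Markov property in the form used below: given the history up to time b, the next label is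
drawn from `stepKernel`. -/
lemma map_chain_prod (hα : 1 / 2 < α) (b : ℕ) :
    ((chain hα).map (Preorder.frestrictLe (π := fun _ => ℕ) b)).compProd (stepKernel hα b) =
      (chain hα).map fun x => (Preorder.frestrictLe (π := fun _ => ℕ) b x, x (b + 1)) := by
  have h := ProbabilityTheory.Kernel.partialTraj_compProd_eq_map_traj (X := fun _ => ℕ)
    (κ := stepKernel hα) (Nat.zero_le b) (x₀ := fun _ => 0)
  rwa [← ProbabilityTheory.Kernel.traj_map_frestrictLe_apply] at h

/-- The trajectories starting at `0` whose first `n` labels after that form the word `w`. -/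
def cylinderSet (n : ℕ) (w : List ℕ) : Set (ℕ → ℕ) :=
  {x | x 0 = 0 ∧ initialWord (fun i => x (i + 1)) n = w}

lemma initialWord_congr {k k' : ℕ → ℕ} {n : ℕ} (h : ∀ i < n, k i = k' i) :
    initialWord k n = initialWord k' n := by
  induction n with
  | zero => rfl
  | succ n ih => rw [initialWord, initialWord, h n (by omega), ih fun i hi => h i (by omega)]

lemma cylinderSet_congr {x y : ℕ → ℕ} {n : ℕ} (h : ∀ i ≤ n, x i = y i) (w : List ℕ) :
    x ∈ cylinderSet n w ↔ y ∈ cylinderSet n w := by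
  have e : initialWord (fun i => x (i + 1)) n = initialWord (fun i => y (i + 1)) n :=
    initialWord_congr fun i hi => h (i + 1) (by omega)
  simp only [cylinderSet, Set.mem_ofPred_eq, h 0 (Nat.zero_le n), e]

lemma eq_lastLabel_of_mem_cylinderSet {x : ℕ → ℕ} {n : ℕ} {w : List ℕ}
    (h : x ∈ cylinderSet n w) : x n = lastLabel w := by
  obtain ⟨h0, rfl⟩ := h
  cases n with
  | zero => exact h0
  | succ n => rfl

lemma cylinderSet_succ (n l : ℕ) (w : List ℕ) :
    cylinderSet (n + 1) (l :: w) = cylinderSet n w ∩ {x | x (n + 1) = l} := by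
  ext x
  simp only [cylinderSet, initialWord, Set.mem_ofPred_eq, List.cons.injEq, mem_inter_iff]
  tauto

lemma chain_cylinderSet (hα : 1 / 2 < α) (w : List ℕ) :
    chain hα (cylinderSet w.length w) = ENNReal.ofReal (mass α w) := by
  induction w with
  | nil =>
    have : chain hα {x | x 0 = 0} = 1 :=
      (measure_congr (eventuallyEq_univ.2 (chain_zero hα))).trans measure_univ
    simpa [cylinderSet, initialWord, mass] using this
  | cons l w ih =>
    set n := w.length
    -- Padding a history with zeros expresses the cylinder as a condition on the history; it does
    -- not depend on later coordinates.
    let ext : (Finset.Iic n → ℕ) → ℕ → ℕ := fun h i =>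
      if hi : i ≤ n then h ⟨i, Finset.mem_Iic.2 hi⟩ else 0
    let B : Set (Finset.Iic n → ℕ) := ext ⁻¹' cylinderSet n w
    have hB : MeasurableSet B := (to_countable _).measurableSet
    have hpre : Preorder.frestrictLe (π := fun _ => ℕ) n ⁻¹' B = cylinderSet n w := by
      ext x
      exact cylinderSet_congr (fun i hi => by simp [ext, hi]) w
    have hm : Measurable (Preorder.frestrictLe (π := fun _ => ℕ) n) :=
      Preorder.measurable_frestrictLe (X := fun _ => ℕ) n
    have hm2 : Measurable fun x : ℕ → ℕ => (Preorder.frestrictLe (π := fun _ => ℕ) n x, x (n + 1)) :=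
      hm.prodMk (measurable_pi_apply _)
    have h := congrArg (fun μ => μ (B ×ˢ {l})) (map_chain_prod hα n)
    rw [Measure.map_apply hm2 (hB.prod (measurableSet_singleton l)),
      Measure.compProd_apply_prod hB (measurableSet_singleton l)] at h
    have hset : (fun x : ℕ → ℕ => (Preorder.frestrictLe (π := fun _ => ℕ) n x, x (n + 1))) ⁻¹'
        (B ×ˢ {l}) = cylinderSet (n + 1) (l :: w) := by
      rw [cylinderSet_succ, ← hpre]
      rfl
    rw [hset, setLIntegral_congr_fun (g := fun _ => ENNReal.ofReal (relMass α (lastLabel w) l)) hB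
      fun y hy => ?_, setLIntegral_const, Measure.map_apply hm hB, hpre, ih] at h
    · rw [List.length_cons, ← h, mass, mul_comm (mass α w),
        ENNReal.ofReal_mul (relMass_nonneg hα _ _)]
    · have e : y ⟨n, Finset.mem_Iic.2 le_rfl⟩ = lastLabel w := by
        have := eq_lastLabel_of_mem_cylinderSet (x := ext y) hy
        simpa [ext] using this
      simp only [stepKernel_apply]
      rw [e, PMF.toMeasure_apply_singleton _ _ (measurableSet_singleton l), stepPMF_apply]

/-! ### Fourier inversion and transience of the chain -/

lemma integral_stepPMF_cos (hα : 1 / 2 < α) (k : ℕ) (θ : ℝ) :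
    ∫ l : ℕ, Real.cos (l * θ) ∂(stepPMF hα k).toMeasure = charFn α θ * Real.cos (k * θ) := by
  rw [PMF.integral_eq_tsum, ← (hasSum_relMass_mul_cos hα k θ).tsum_eq]
  · refine tsum_congr fun l => ?_
    rw [stepPMF_apply, ENNReal.toReal_ofReal (relMass_nonneg hα k l), smul_eq_mul]
  · exact Integrable.of_bound (measurable_of_countable _).aestronglyMeasurable 1
      (Eventually.of_forall fun l => Real.abs_cos_le_one _)

lemma integral_chain_cos (hα : 1 / 2 < α) (n : ℕ) (θ : ℝ) :
    ∫ x, Real.cos (x n * θ) ∂chain hα = charFn α θ ^ n := by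
  have hcos : Measurable fun l : ℕ => Real.cos (l * θ) := measurable_of_countable _
  induction n with
  | zero =>
    rw [integral_congr_ae (g := fun _ => (1 : ℝ))]
    · simp
    · filter_upwards [chain_zero hα] with x hx
      simp [hx]
  | succ n ih =>
    have hm : Measurable (Preorder.frestrictLe (π := fun _ => ℕ) n) :=
      Preorder.measurable_frestrictLe (X := fun _ => ℕ) n
    have hm2 : Measurable fun x : ℕ → ℕ => (Preorder.frestrictLe (π := fun _ => ℕ) n x, x (n + 1)) :=
      hm.prodMk (measurable_pi_apply _)
    have hc2 : Measurable fun z : (Finset.Iic n → ℕ) × ℕ => Real.cos (z.2 * θ) :=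
      hcos.comp measurable_snd
    calc ∫ x, Real.cos (x (n + 1) * θ) ∂chain hα
        = ∫ z, Real.cos (z.2 * θ) ∂((chain hα).map fun x =>
            (Preorder.frestrictLe (π := fun _ => ℕ) n x, x (n + 1))) :=
          (integral_map hm2.aemeasurable hc2.aestronglyMeasurable).symm
      _ = ∫ h, ∫ l, Real.cos (l * θ) ∂(stepKernel hα n h)
            ∂((chain hα).map (Preorder.frestrictLe (π := fun _ => ℕ) n)) := by
          rw [← map_chain_prod]
          have := Measure.isProbabilityMeasure_map (μ := chain hα) hm.aemeasurable
          exact Measure.integral_compProd (Integrable.of_bound hc2.aestronglyMeasurable 1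
            (Eventually.of_forall fun z => Real.abs_cos_le_one _))
      _ = ∫ h, charFn α θ * Real.cos (h ⟨n, Finset.mem_Iic.2 le_rfl⟩ * θ)
            ∂((chain hα).map (Preorder.frestrictLe (π := fun _ => ℕ) n)) :=
          integral_congr_ae (Eventually.of_forall fun h => integral_stepPMF_cos hα _ θ)
      _ = charFn α θ * ∫ x, Real.cos (x n * θ) ∂chain hα := by
          rw [integral_const_mul]
          exact congrArg _ (integral_map hm.aemeasurable
            (hcos.comp (measurable_pi_apply _)).aestronglyMeasurable)
      _ = charFn α θ ^ (n + 1) := by rw [ih, pow_succ']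

/-- Orthogonality of the cosines on [0, π] picks out the event, and Fubini moves the expectation
inside the integral. -/
lemma chain_real_mul (hα : 1 / 2 < α) (n j : ℕ) :
    (chain hα).real {x | x n = j} * (if j = 0 then Real.pi else Real.pi / 2) =
      ∫ θ in (0 : ℝ)..Real.pi, Real.cos (j * θ) * charFn α θ ^ n := by
  have hset : MeasurableSet {x : ℕ → ℕ | x n = j} :=
    (measurable_pi_apply (X := fun _ => ℕ) n) (measurableSet_singleton j)
  have hmeas : Measurable fun p : ℝ × (ℕ → ℕ) => Real.cos (j * p.1) * Real.cos (p.2 n * p.1) := by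
    have : Measurable fun p : ℝ × (ℕ → ℕ) => (p.2 n : ℝ) :=
      (measurable_of_countable fun m : ℕ => (m : ℝ)).comp
        ((measurable_pi_apply n).comp measurable_snd)
    fun_prop
  calc (chain hα).real {x | x n = j} * (if j = 0 then Real.pi else Real.pi / 2)
      = ∫ x, ({x | x n = j}.indicator fun _ => (if j = 0 then Real.pi else Real.pi / 2)) x
          ∂chain hα := by rw [integral_indicator_const _ hset, smul_eq_mul]
    _ = ∫ x, (∫ θ in (0 : ℝ)..Real.pi, Real.cos (j * θ) * Real.cos (x n * θ)) ∂chain hα := by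
        refine integral_congr_ae (Eventually.of_forall fun x => ?_)
        simp only [integral_cos_mul_cos, Set.indicator_apply, Set.mem_ofPred_eq]
    _ = ∫ θ in (0 : ℝ)..Real.pi, (∫ x, Real.cos (j * θ) * Real.cos (x n * θ) ∂chain hα) := by
        simp only [intervalIntegral.integral_of_le Real.pi_pos.le]
        refine (integral_integral_swap ?_).symm
        refine Integrable.of_bound hmeas.aestronglyMeasurable 1 (Eventually.of_forall fun p => ?_)
        rw [Function.uncurry_def, norm_mul]
        exact mul_le_one₀ (Real.abs_cos_le_one _) (norm_nonneg _) (Real.abs_cos_le_one _)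
    _ = _ := by simp only [integral_const_mul, integral_chain_cos hα]

/-- The sum is the expected number of visits to j. The Fourier weight is at least π/2 for every j,
which gives the bound C / (π/2). -/
lemma tsum_chain_ne_top (hα : 1 / 2 < α) (hα' : α < 1) (j : ℕ) :
    ∑' n, chain hα {x | x n = j} ≠ ⊤ := by
  obtain ⟨C, hC⟩ := exists_sum_integral_le hα hα'
  have hpi := Real.pi_pos
  refine ne_top_of_le_ne_top ENNReal.ofReal_ne_top
    (ENNReal.tsum_le_of_sum_range_le (c := ENNReal.ofReal (C / (Real.pi / 2))) fun N => ?_)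
  have h1 : ∑ n ∈ Finset.range N, (chain hα).real {x | x n = j} ≤ C / (Real.pi / 2) := by
    rw [le_div_iff₀ (by positivity), Finset.sum_mul]
    refine le_trans (Finset.sum_le_sum fun n _ => ?_) (hC j N)
    rw [← chain_real_mul hα]
    refine mul_le_mul_of_nonneg_left ?_ measureReal_nonneg
    split_ifs <;> linarith
  refine le_trans (le_of_eq ?_) (ENNReal.ofReal_le_ofReal h1)
  rw [ENNReal.ofReal_sum_of_nonneg fun _ _ => measureReal_nonneg]
  simp

/-- Label transience of the chain. -/
lemma chain_tendsto (hα : 1 / 2 < α) (hα' : α < 1) :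
    ∀ᵐ x ∂chain hα, Tendsto x atTop atTop := by
  have h : ∀ᵐ x ∂chain hα, ∀ j, ∀ᶠ n in atTop, x ∉ {x : ℕ → ℕ | x n = j} :=
    ae_all_iff.2 fun j => ae_eventually_notMem (tsum_chain_ne_top hα hα' j)
  filter_upwards [h] with x hx
  refine tendsto_atTop.2 fun b => ?_
  have : ∀ᶠ n in atTop, ∀ j ∈ Finset.range b, x n ≠ j :=
    (eventually_all_finset _).2 fun j _ => hx j
  filter_upwards [this] with n hn
  by_contra! hlt
  exact hn _ (Finset.mem_range.2 hlt) rfl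

/-! ### Existence and uniqueness of the label measure -/

lemma measurableSet_initialWord_eq (n : ℕ) (w : List ℕ) :
    MeasurableSet {k : ℕ → ℕ | initialWord k n = w} := by
  induction n generalizing w with
  | zero => exact MeasurableSet.const ([] = w)
  | succ n ih =>
    cases w with
    | nil => simp [initialWord]
    | cons l w =>
      have : {k : ℕ → ℕ | initialWord k (n + 1) = l :: w} =
          (fun k : ℕ → ℕ => k n) ⁻¹' {l} ∩ {k | initialWord k n = w} := by
        ext k
        simp [initialWord]
      rw [this]
      exact ((measurable_pi_apply n) (measurableSet_singleton l)).inter (ih w)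

lemma measurable_comp_initialWord (f : List ℕ → ℝ) (n : ℕ) :
    Measurable fun k : ℕ → ℕ => f (initialWord k n) := by
  intro s _
  have : (fun k : ℕ → ℕ => f (initialWord k n)) ⁻¹' s =
      ⋃ w ∈ f ⁻¹' s, {k : ℕ → ℕ | initialWord k n = w} := by
    ext k
    simp
  rw [this]
  exact MeasurableSet.biUnion (to_countable _) fun w _ => measurableSet_initialWord_eq n w

lemma measurable_point : Measurable point :=
  Measurable.iSup fun n => measurable_comp_initialWord left n

/-- A word fails to be admissible only through a step from label 0 to label 0, and that step has
mass 0. Hence the chain almost surely produces admissible words. -/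
lemma mass_eq_zero (hα : 1 / 2 < α) {w : List ℕ} (hw : ¬ Admissible w) : mass α w = 0 := by
  induction w with
  | nil => exact absurd trivial hw
  | cons l w ih =>
    rw [mass]
    by_cases h : Admissible w
    · have h' : lastLabel w = 0 ∧ l = 0 := by
        by_contra hcon
        exact hw ⟨fun h1 h2 => hcon ⟨h1, h2⟩, h⟩
      rw [h'.1, h'.2, relMass_zero_zero hα, mul_zero]
    · rw [ih h, zero_mul]

lemma chain_admissible (hα : 1 / 2 < α) :
    ∀ᵐ x ∂chain hα, AdmissibleSeq fun i => x (i + 1) := by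
  have h : ∀ᵐ x ∂chain hα, ∀ w : List ℕ, ¬ Admissible w → x ∉ cylinderSet w.length w := by
    refine ae_all_iff.2 fun w => ?_
    by_cases hw : Admissible w
    · exact Eventually.of_forall fun x h => absurd hw h
    · have h0 : chain hα (cylinderSet w.length w) = 0 := by
        rw [chain_cylinderSet, mass_eq_zero hα hw, ENNReal.ofReal_zero]
      filter_upwards [measure_eq_zero_iff_ae_notMem.1 h0] with x hx _ using hx
  filter_upwards [h, chain_zero hα] with x hx hx0 n
  by_contra hn
  exact hx _ hn ⟨hx0, by rw [length_initialWord]⟩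

/-- The law of the point coded by the label chain. -/
noncomputable def labelMeasure (hα : 1 / 2 < α) : Measure ℝ :=
  (chain hα).map fun x => point fun i => x (i + 1)

lemma measurable_point_shift : Measurable fun x : ℕ → ℕ => point fun i => x (i + 1) :=
  measurable_point.comp (measurable_pi_lambda _ fun i => measurable_pi_apply (i + 1))

instance (hα : 1 / 2 < α) : IsProbabilityMeasure (labelMeasure hα) :=
  Measure.isProbabilityMeasure_map measurable_point_shift.aemeasurable

lemma chain_point_mem_dissipative (hα : 1 / 2 < α) (hα' : α < 1) :
    ∀ᵐ x ∂chain hα, (point fun i => x (i + 1)) ∈ dissipative := by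
  filter_upwards [chain_admissible hα, chain_tendsto hα hα'] with x h1 h2
  exact point_mem_dissipative h1 ((tendsto_add_atTop_iff_nat 1).2 h2)

lemma labelMeasure_dissipative (hα : 1 / 2 < α) (hα' : α < 1) :
    labelMeasure hα dissipative = 1 := by
  refine le_antisymm prob_le_one ?_
  have h : chain hα ((fun x : ℕ → ℕ => point fun i => x (i + 1)) ⁻¹' dissipative) = 1 :=
    (measure_congr (eventuallyEq_univ.2 (chain_point_mem_dissipative hα hα'))).trans measure_univ
  rw [← h]
  -- This inequality holds for arbitrary sets, so measurability of `dissipative` is not needed.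
  exact Measure.le_map_apply measurable_point_shift.aemeasurable _

lemma isLabelMeasure_labelMeasure (hα : 1 / 2 < α) (hα' : α < 1) :
    IsLabelMeasure α (labelMeasure hα) := by
  refine ⟨?_, fun w hw => ?_⟩
  · rw [labelMeasure, Measure.map_apply measurable_point_shift measurableSet_cantor.compl]
    refine measure_eq_zero_iff_ae_notMem.2 ?_
    filter_upwards [chain_point_mem_dissipative hα hα'] with x hx h
    exact h hx.1
  · rw [labelMeasure, Measure.map_apply measurable_point_shift (measurableSet_interval w),
      ← chain_cylinderSet hα]
    refine measure_congr ?_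
    filter_upwards [chain_admissible hα, chain_tendsto hα hα', chain_zero hα] with x h1 h2 h3
    refine propext ?_
    have hp := point_mem_interval h1 ((tendsto_add_atTop_iff_nat 1).2 h2) w.length
    change (point fun i => x (i + 1)) ∈ interval w ↔ x ∈ cylinderSet w.length w
    constructor
    · intro h
      refine ⟨h3, ?_⟩
      -- Intervals of one level are disjoint, so the point determines its word of each length.
      by_contra hne
      exact Set.disjoint_left.1 (disjoint_interval (h1 _) hw (length_initialWord _ _) hne) hp h
    · rintro ⟨_, h⟩
      rwa [h] at hp

/-- The admissible words of length `n + 1` whose fundamental interval lies in `U`. -/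
def innerWords (U : Set ℝ) (n : ℕ) : Set (List ℕ) :=
  {w | w.length = n + 1 ∧ Admissible w ∧ interval w ⊆ U}

/-- A point of the Cantor set also lies in an interval of the next level, whose parent is the given
interval by disjointness. -/
lemma monotone_inner (U : Set ℝ) :
    Monotone fun n => (⋃ w ∈ innerWords U n, interval w) ∩ cantor := by
  refine monotone_nat_of_le_succ fun n x => ?_
  rintro ⟨hx, hc⟩
  obtain ⟨w, ⟨hl, hw, hU⟩, hxw⟩ := mem_iUnion₂.1 hx
  obtain ⟨v, hvl, hv, hxv⟩ := exists_word_of_mem_cantor hc (n + 1)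
  refine ⟨mem_iUnion₂.2 ⟨v, ⟨hvl, hv, ?_⟩, hxv⟩, hc⟩
  cases v with
  | nil => simp at hvl
  | cons l v =>
    have hvw : v = w := by
      by_contra hne
      exact Set.disjoint_left.1 (disjoint_interval hv.2 hw (by simp_all) hne)
        (interval_cons_subset hv hxv) hxw
    subst hvw
    exact (interval_cons_subset hv).trans hU

/-- Lengths decay geometrically with the level, so a small enough interval around x fits inside U.
-/
lemma iUnion_inner {U : Set ℝ} (hU : IsOpen U) :
    ⋃ n, (⋃ w ∈ innerWords U n, interval w) ∩ cantor = U ∩ cantor := by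
  refine Subset.antisymm (iUnion_subset fun n => inter_subset_inter_left _
    (iUnion₂_subset fun w hw => hw.2.2)) ?_
  rintro x ⟨hx, hc⟩
  obtain ⟨ε, hε, hball⟩ := Metric.isOpen_iff.1 hU x hx
  obtain ⟨n, hn⟩ := exists_pow_lt_of_lt_one hε three_div_pi_sq_lt_one
  obtain ⟨w, hl, hw, hxw⟩ := exists_word_of_mem_cantor hc n
  refine mem_iUnion.2 ⟨n, mem_iUnion₂.2 ⟨w, ⟨hl, hw, fun y hy => hball ?_⟩, hxw⟩, hc⟩
  have h1 : len w < ε := by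
    refine (len_le hw).trans_lt (lt_of_le_of_lt ?_ hn)
    rw [hl]
    exact pow_le_pow_of_le_one three_div_pi_sq_pos.le three_div_pi_sq_lt_one.le (Nat.le_succ n)
  simp only [interval, mem_Ico] at hxw hy
  rw [Metric.mem_ball, Real.dist_eq, abs_lt]
  constructor <;> linarith

/-- The right-hand side does not involve μ, so label measures agree on open sets, which form a
generating π-system. -/
lemma IsLabelMeasure.measure_isOpen {μ : Measure ℝ} (h : IsLabelMeasure α μ) {U : Set ℝ}
    (hU : IsOpen U) : μ U = ⨆ n, ∑' w : innerWords U n, ENNReal.ofReal (mass α w) := by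
  rw [← measure_inter_conull h.1, ← iUnion_inner hU, (monotone_inner U).measure_iUnion]
  refine iSup_congr fun n => ?_
  rw [measure_inter_conull h.1, measure_biUnion (to_countable _) ?_
    fun w _ => measurableSet_interval w]
  · exact tsum_congr fun w => h.2 w w.2.2.1
  · intro v hv w hw hvw
    exact disjoint_interval hv.2.1 hw.2.1 (hv.1.trans hw.1.symm) hvw

lemma IsLabelMeasure.measure_univ {μ : Measure ℝ} (h : IsLabelMeasure α μ) : μ univ = 1 := by
  have hc : cantor ⊆ interval [] := fun x hx => by
    obtain ⟨w, -, hw, hxw⟩ := exists_word_of_mem_cantor hx 0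
    exact interval_subset_unit hw hxw
  have h1 : μ (interval []) = 1 := by simpa [mass] using h.2 [] trivial
  refine le_antisymm ?_ (h1 ▸ measure_mono (subset_univ _))
  rw [← measure_inter_conull h.1, univ_inter, ← h1]
  exact measure_mono hc

lemma IsLabelMeasure.unique {μ ν : Measure ℝ} (hμ : IsLabelMeasure α μ)
    (hν : IsLabelMeasure α ν) : μ = ν := by
  have : IsFiniteMeasure μ := ⟨by rw [hμ.measure_univ]; exact ENNReal.one_lt_top⟩
  refine ext_of_generate_finite {U : Set ℝ | IsOpen U} (BorelSpace.measurable_eq (α := ℝ))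
    isPiSystem_isOpen (fun U hU => ?_) (hμ.measure_univ.trans hν.measure_univ.symm)
  rw [hμ.measure_isOpen hU, hν.measure_isOpen hU]

end LabelCantor

theorem corollary2p4 (α : ℝ) (hα : 1 / 2 < α) (hα' : α < 1) :
    (∃! μ : Measure ℝ, LabelCantor.IsLabelMeasure α μ) ∧
      ∀ μ : Measure ℝ, LabelCantor.IsLabelMeasure α μ →
        IsProbabilityMeasure μ ∧ μ LabelCantor.dissipative = 1 := by
  have h := LabelCantor.isLabelMeasure_labelMeasure hα hα'
  refine ⟨⟨_, h, fun ν hν => hν.unique h⟩, fun μ hμ => ?_⟩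
  rw [hμ.unique h]
  exact ⟨inferInstance, LabelCantor.labelMeasure_dissipative hα hα'⟩
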